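/- Let $\mathcal X$ and $\hat{\mathcal X}$ be finite sets, $M:=|\hat{\mathcal X}|$, let $p_X$ be a probability distribution on $\mathcal X$ and $d:\mathcal X\times\hat{\mathcal X}\to[0,\infty)$ a distortion measure. Let $\Delta[\hat{\mathcal X}]\subset\mathbb R^M$ be the simplex of probability distributions on $\hat{\mathcal X}$, and for $\delta>0$ let its closed $\delta$-interior be the set of $r\in\Delta[\hat{\mathcal X}]$ with $r(\hat x)\ge\delta$ for all $\hat x\in\hat{\mathcal X}$. For $\beta\in\mathbb R$ and $r\in\mathbb R^M$ consider the Blahut--Arimoto operator $$BA_\beta[r](\hat x):=r(\hat x)\sum_{x}\frac{p_X(x)\,e^{-\beta d(x,\hat x)}}{\sum_{\hat x'}r(\hat x')\,e^{-\beta d(x,\hat x')}} .$$ Each coordinate of $(\mathrm{Id}-BA_\beta)[r]$ is a smooth function of $(r,\beta)$ near every point of $\Delta[\hat{\mathcal X}]\times\mathbb R$. For $b,m\ge 0$ and $i_1,\dots,i_m\in\hat{\mathcal X}$ write $$\left(D^{b+m}_{\beta^b,r^m}(\mathrm{Id}-BA_\beta)[r](\hat x)\right)_{(i_1,\dots,i_m)}:=\frac{\partial^m}{\partial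 r(i_1)\cdots\partial r(i_m)}\frac{\partial^b}{\partial\beta^b}(\mathrm{Id}-BA_\beta)[r](\hat x)$$ for the entries of its derivative tensors, and put $$C(b,m;d,M):=2\max\{1,b\}\,(m+1)!\binom{b+M-1}{b}\left[m!\;p(b)\left(2^b\,b!\,d_{max}^{\,b^2}\right)^{1+m}\right]^M,$$ where $d_{max}:=\max\{1,\max_{x,\hat x}d(x,\hat x)\}$ and $p(b)$ is the number of integer partitions of $b$ (so $p(0)=1$). Then for every $\delta>0$, all $b,m\ge0$ other than $b=m=0$, every $\beta\in\mathbb R$, every $r$ in the closed $\delta$-interior of $\Delta[\hat{\mathcal X}]$, every $\hat x\in\hat{\mathcal X}$ and all $i_1,\dots,i_m\in\hat{\mathcal X}$, $$\left|\left(D^{b+m}_{\beta^b,r^m}(\mathrm{Id}-BA_\beta)[r](\hat x)\right)_{(i_1,\dots,i_m)}\right|\le 1+\frac1{\delta^m}\,C(b,m;d,M).$$ Moreover, for every $b\ge1$, $\beta\in\mathbb R$, $\hat x\in\hat{\mathcal X}$ and every $r$ in the whole simplex $\Delta[\hat{\mathcal X}]$, $$\left|\frac{\partial^b}{\partial\beta^b}(\mathrm{Id}-BA_\beta)[r](\hat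 x)\right|\le 1+C(b,0;d,M).$$ -/

import Mathlib

open scoped ContDiff

noncomputable section

namespace RateDistortion

variable {X Y : Type*} [Fintype X] [Fintype Y]

/-- The normalization `Z(x, β) = ∑ y, r(y) exp(-β d(x, y))` of the encoder. -/
def partitionFun (d : X → Y → ℝ) (β : ℝ) (r : Y → ℝ) (x : X) : ℝ :=
  ∑ y, r y * Real.exp (-β * d x y)

/-- The encoder `q(y | x) = r(y) exp(-β d(x, y)) / Z(x, β)` defined by a marginal `r`. -/
def encoder (d : X → Y → ℝ) (β : ℝ) (r : Y → ℝ) (y : Y) (x : X) : ℝ :=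
  r y * Real.exp (-β * d x y) / partitionFun d β r x

/-- One Blahut-Arimoto iteration `BA_β` in marginal coordinates, given by its formula for
every vector `r` of `ℝ^Y`. -/
def blahutArimoto (p : X → ℝ) (d : X → Y → ℝ) (β : ℝ) (r : Y → ℝ) : Y → ℝ :=
  fun y => ∑ x, p x * encoder d β r y x

/-- The operator `Id - BA_β`. -/
def rdOperator (p : X → ℝ) (d : X → Y → ℝ) (β : ℝ) (r : Y → ℝ) : Y → ℝ :=
  r - blahutArimoto p d β r

/-- The closed `δ`-interior of the simplex of distributions on `Y`. -/
def closedInterior (Y : Type*) [Fintype Y] (δ : ℝ) : Set (Y → ℝ) :=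
  {r | r ∈ stdSimplex ℝ Y ∧ ∀ y, δ ≤ r y}

/-- The `y`-th component of the derivative tensor `D^{b+m}_{β^b, r^m} (Id - BA_β)` at `(r, β)`:
the `m`-th derivative with respect to `r`, an `m`-multilinear form, of the `b`-th partial
derivative with respect to `β`. -/
def derivTensor (p : X → ℝ) (d : X → Y → ℝ) (b m : ℕ) (β : ℝ) (r : Y → ℝ) (y : Y) :
    ContinuousMultilinearMap ℝ (fun _ : Fin m => Y → ℝ) ℝ :=
  iteratedFDeriv ℝ m (fun s : Y → ℝ => iteratedDeriv b (fun t : ℝ => rdOperator p d t s y) β) r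

/-- The entry with index `(i₁, …, iₘ)` of the derivative tensor: its value at the standard
basis vectors `e_{i₁}, …, e_{iₘ}`. -/
def derivTensorEntry [DecidableEq Y] (p : X → ℝ) (d : X → Y → ℝ) (b m : ℕ) (β : ℝ) (r : Y → ℝ)
    (y : Y) (i : Fin m → Y) : ℝ :=
  derivTensor p d b m β r y (fun j => Pi.single (i j) (1 : ℝ))

/-- `d_max = max {1, max_{x, y} d(x, y)}`. -/
def distortionMax (d : X → Y → ℝ) : ℝ :=
  max 1 (⨆ z : X × Y, d z.1 z.2)

/-- The constant `C(b, m; d, M)`, with `M` the size of the alphabet `Y`; the cardinality of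
`Nat.Partition b` is the number `p(b)` of integer partitions of `b`. -/
def tensorConst (d : X → Y → ℝ) (b m : ℕ) : ℝ :=
  2 * (max 1 b : ℕ) * ((m + 1).factorial : ℝ) *
    (Nat.choose (b + Fintype.card Y - 1) b : ℝ) *
    ((m.factorial : ℝ) * (Fintype.card (Nat.Partition b) : ℝ) *
      ((2 : ℝ) ^ b * (b.factorial : ℝ) * distortionMax d ^ (b ^ 2)) ^ (1 + m)) ^ Fintype.card Y

end RateDistortion

end

open scoped ContDiff

/-! At each `x`, write ⟨F⟩ for the encoder average of `F` and wᵢ for q(i|x)/r(i). Differentiation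
keeps polynomials in these: ∂_β⟨F⟩ = ⟨F⟩⟨d⟩ - ⟨dF⟩, ∂_β wᵢ = wᵢ⟨d⟩ - dᵢwᵢ, ∂ᵢ⟨F⟩ = wᵢ(Fᵢ - ⟨F⟩),
∂ᵢwⱼ = -wᵢwⱼ. So on a polynomial of degree n a derivative raises the degree by at most one and
multiplies the sum of absolute coefficients by at most 2n (times D ≥ |d| for β); each r-derivative
adds exactly one w to every monomial. `EncoderPoly` does this bookkeeping. `blahutArimoto` is a
convex combination of averages of an indicator, so b + m derivatives give coefficient sum 2^(b+m)
(b+m)! D^b. Since |⟨F⟩| ≤ 1 and wᵢ ≤ 1/δ, `EncoderPoly.abs_le` bounds the result by that sum over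
δ^m, well below `tensorConst`. The identity contributes at most 1. -/

namespace RateDistortion

/-! ### The partition function and its derivatives -/

section Partition

variable {X Y : Type*} [Fintype Y] (d : X → Y → ℝ)

theorem partitionFun_pos {r : Y → ℝ} (h0 : ∀ y, 0 ≤ r y) (h1 : ∃ y, 0 < r y) (t : ℝ) (x : X) :
    0 < partitionFun d t r x := by
  obtain ⟨y, hy⟩ := h1
  exact Finset.sum_pos' (fun z _ => mul_nonneg (h0 z) (Real.exp_pos _).le)
    ⟨y, Finset.mem_univ _, mul_pos hy (Real.exp_pos _)⟩

theorem hasDerivAt_partitionFun (r : Y → ℝ) (t : ℝ) (x : X) :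
    HasDerivAt (fun s => partitionFun d s r x) (-partitionFun d t (d x * r) x) t := by
  have h : ∀ y ∈ (Finset.univ : Finset Y), HasDerivAt (fun s : ℝ => r y * Real.exp (-s * d x y))
      (r y * (Real.exp (-t * d x y) * (-1 * d x y))) t := fun y _ =>
    ((((hasDerivAt_id t).neg).mul_const (d x y)).exp).const_mul (r y)
  refine (HasDerivAt.fun_sum h).congr_deriv ?_
  rw [partitionFun, ← Finset.sum_neg_distrib]
  refine Finset.sum_congr rfl fun y _ => ?_
  simp only [Pi.mul_apply]
  ring

theorem partitionFun_mul_add_single [DecidableEq Y] (F r : Y → ℝ) (i : Y) (s t : ℝ) (x : X) :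
    partitionFun d t (F * (r + s • Pi.single i (1 : ℝ))) x =
      partitionFun d t (F * r) x + s * (F i * Real.exp (-t * d x i)) := by
  simp only [partitionFun, Pi.mul_apply, Pi.add_apply, Pi.smul_apply, smul_eq_mul, mul_add,
    add_mul, Finset.sum_add_distrib]
  congr 1
  rw [Finset.sum_eq_single i]
  · simp
    ring
  · intro y _ hy
    simp [Pi.single_eq_of_ne hy]
  · simp

theorem hasLineDerivAt_partitionFun_mul [DecidableEq Y] (F r : Y → ℝ) (i : Y) (t : ℝ) (x : X) :
    HasLineDerivAt ℝ (fun r => partitionFun d t (F * r) x) (F i * Real.exp (-t * d x i)) r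
      (Pi.single i 1) := by
  unfold HasLineDerivAt
  simp only [partitionFun_mul_add_single]
  simpa using ((hasDerivAt_id (0 : ℝ)).mul_const (F i * Real.exp (-t * d x i))).const_add
    (partitionFun d t (F * r) x)

theorem hasLineDerivAt_partitionFun [DecidableEq Y] (r : Y → ℝ) (i : Y) (t : ℝ) (x : X) :
    HasLineDerivAt ℝ (fun r => partitionFun d t r x) (Real.exp (-t * d x i)) r
      (Pi.single i 1) := by
  simpa using hasLineDerivAt_partitionFun_mul d 1 r i t x

theorem contDiff_partitionFun_mul (F : Y → ℝ) (x : X) :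
    ContDiff ℝ ∞ (fun z : (Y → ℝ) × ℝ => partitionFun d z.2 (F * z.1) x) := by
  simp only [partitionFun, Pi.mul_apply]
  fun_prop

theorem contDiff_partitionFun (x : X) :
    ContDiff ℝ ∞ (fun z : (Y → ℝ) × ℝ => partitionFun d z.2 z.1 x) := by
  simp only [partitionFun]
  fun_prop

theorem abs_partitionFun_mul_le {F r : Y → ℝ} (hF : ∀ y, |F y| ≤ 1) (h0 : ∀ y, 0 ≤ r y) (t : ℝ)
    (x : X) : |partitionFun d t (F * r) x| ≤ partitionFun d t r x := by
  refine (Finset.abs_sum_le_sum_abs _ _).trans (Finset.sum_le_sum fun y _ => ?_)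
  rw [Pi.mul_apply, abs_mul, abs_mul, abs_of_nonneg (h0 y), abs_of_pos (Real.exp_pos _)]
  exact mul_le_mul_of_nonneg_right (mul_le_of_le_one_left (h0 y) (hF y)) (Real.exp_pos _).le

theorem mul_exp_le_partitionFun {r : Y → ℝ} (h0 : ∀ y, 0 ≤ r y) (i : Y) (t : ℝ) (x : X) :
    r i * Real.exp (-t * d x i) ≤ partitionFun d t r x :=
  Finset.single_le_sum (f := fun y => r y * Real.exp (-t * d x y))
    (fun y _ => mul_nonneg (h0 y) (Real.exp_pos _).le) (Finset.mem_univ i)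

end Partition

/-! ### Encoder averages and ratios: derivatives and bounds -/

/-- The average `⟨F⟩ = ∑ y, F(y) q(y | x)` of `F` under the encoder of `r`. -/
noncomputable def encoderAvg {X Y : Type*} [Fintype Y] (d : X → Y → ℝ) (x : X) (F : Y → ℝ)
    (r : Y → ℝ) (t : ℝ) : ℝ :=
  partitionFun d t (F * r) x / partitionFun d t r x

/-- The ratio `q(i | x) / r(i)`, written without dividing by `r(i)`. -/
noncomputable def weightRatio {X Y : Type*} [Fintype Y] (d : X → Y → ℝ) (x : X) (i : Y)
    (r : Y → ℝ) (t : ℝ) : ℝ :=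
  Real.exp (-t * d x i) / partitionFun d t r x

section Factors

variable {X Y : Type*} [Fintype Y] (d : X → Y → ℝ)

theorem hasDerivAt_encoderAvg {r : Y → ℝ} {t : ℝ} {x : X} (hZ : partitionFun d t r x ≠ 0)
    (F : Y → ℝ) :
    HasDerivAt (encoderAvg d x F r)
      (encoderAvg d x F r t * encoderAvg d x (d x) r t - encoderAvg d x (d x * F) r t) t := by
  refine ((hasDerivAt_partitionFun d (F * r) t x).div
    (hasDerivAt_partitionFun d r t x) hZ).congr_deriv ?_
  simp only [encoderAvg, mul_assoc]
  field_simp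
  ring

theorem hasDerivAt_weightRatio {r : Y → ℝ} {t : ℝ} {x : X} (hZ : partitionFun d t r x ≠ 0)
    (i : Y) :
    HasDerivAt (weightRatio d x i r)
      (weightRatio d x i r t * encoderAvg d x (d x) r t - d x i * weightRatio d x i r t) t := by
  have h := (((hasDerivAt_id t).neg).mul_const (d x i)).exp
  refine (h.div (hasDerivAt_partitionFun d r t x) hZ).congr_deriv ?_
  simp only [encoderAvg, weightRatio, id, Pi.neg_apply]
  field_simp
  ring

theorem hasLineDerivAt_encoderAvg [DecidableEq Y] {r : Y → ℝ} {t : ℝ} {x : X}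
    (hZ : partitionFun d t r x ≠ 0) (F : Y → ℝ) (i : Y) :
    HasLineDerivAt ℝ (fun r => encoderAvg d x F r t)
      (F i * weightRatio d x i r t - weightRatio d x i r t * encoderAvg d x F r t) r
      (Pi.single i 1) := by
  have hZ' : partitionFun d t (r + (0 : ℝ) • Pi.single i 1) x ≠ 0 := by simpa using hZ
  refine (HasDerivAt.div (hasLineDerivAt_partitionFun_mul d F r i t x)
    (hasLineDerivAt_partitionFun d r i t x) hZ').congr_deriv ?_
  simp only [encoderAvg, weightRatio, zero_smul, add_zero]
  field_simp

theorem hasLineDerivAt_weightRatio [DecidableEq Y] {r : Y → ℝ} {t : ℝ} {x : X}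
    (hZ : partitionFun d t r x ≠ 0) (j i : Y) :
    HasLineDerivAt ℝ (fun r => weightRatio d x j r t)
      (-(weightRatio d x i r t * weightRatio d x j r t)) r (Pi.single i 1) := by
  have hZ' : partitionFun d t (r + (0 : ℝ) • Pi.single i 1) x ≠ 0 := by simpa using hZ
  refine (HasDerivAt.div (hasDerivAt_const (0 : ℝ) (Real.exp (-t * d x j)))
    (hasLineDerivAt_partitionFun d r i t x) hZ').congr_deriv ?_
  simp only [weightRatio, zero_smul, add_zero]
  field_simp
  ring

theorem weightRatio_nonneg {r : Y → ℝ} (h0 : ∀ y, 0 ≤ r y) (t : ℝ) (x : X) (i : Y) :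
    0 ≤ weightRatio d x i r t :=
  div_nonneg (Real.exp_pos _).le
    (Finset.sum_nonneg fun y _ => mul_nonneg (h0 y) (Real.exp_pos _).le)

/-- The product of r(i) and the ratio is the probability q(i|x) ≤ 1, and r(i) ≥ δ. -/
theorem weightRatio_le {δ : ℝ} (hδ : 0 < δ) {r : Y → ℝ} (h : ∀ y, δ ≤ r y) (t : ℝ) (x : X)
    (i : Y) : weightRatio d x i r t ≤ 1 / δ := by
  have h0 : ∀ y, 0 < r y := fun y => hδ.trans_le (h y)
  have hZ := partitionFun_pos d (fun y => (h0 y).le) ⟨i, h0 i⟩ t x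
  rw [weightRatio, div_le_div_iff₀ hZ hδ, one_mul, mul_comm]
  exact (mul_le_mul_of_nonneg_right (h i) (Real.exp_pos _).le).trans
    (mul_exp_le_partitionFun d (fun y => (h0 y).le) i t x)

theorem abs_encoderAvg_le {F r : Y → ℝ} (hF : ∀ y, |F y| ≤ 1) (h0 : ∀ y, 0 ≤ r y)
    {t : ℝ} {x : X} (hZ : 0 < partitionFun d t r x) : |encoderAvg d x F r t| ≤ 1 := by
  rw [encoderAvg, abs_div, abs_of_pos hZ, div_le_one hZ]
  exact abs_partitionFun_mul_le d hF h0 t x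

theorem encoder_eq_encoderAvg [DecidableEq Y] (r : Y → ℝ) (t : ℝ) (y : Y) (x : X) :
    encoder d t r y x = encoderAvg d x (Pi.single y 1) r t := by
  rw [encoder, encoderAvg]
  congr 1
  rw [partitionFun, Finset.sum_eq_single y]
  · simp
  · intro z _ hz
    simp [Pi.single_eq_of_ne hz]
  · simp

end Factors

/-! ### The calculus of encoder polynomials -/

/-- `EncoderPoly d n m A f` says that `f` is a polynomial of degree at most `n` in the averages
`encoderAvg d x F` with `|F| ≤ 1` and the ratios `weightRatio d x i`, in which every monomial has
exactly `m` ratios and the absolute values of the coefficients add up to at most `A`. -/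
inductive EncoderPoly {X Y : Type*} [Fintype Y] (d : X → Y → ℝ) :
    ℕ → ℕ → ℝ → ((Y → ℝ) → ℝ → ℝ) → Prop
  | zero (n m : ℕ) : EncoderPoly d n m 0 (fun _ _ => 0)
  | avg (x : X) (F : Y → ℝ) (hF : ∀ y, |F y| ≤ 1) : EncoderPoly d 1 0 1 (encoderAvg d x F)
  | ratio (x : X) (i : Y) : EncoderPoly d 1 1 1 (weightRatio d x i)
  | smul (c : ℝ) {n m : ℕ} {A : ℝ} {f : (Y → ℝ) → ℝ → ℝ} (hf : EncoderPoly d n m A f) :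
      EncoderPoly d n m (|c| * A) (fun r t => c * f r t)
  | mul {n n' m m' : ℕ} {A A' : ℝ} {f g : (Y → ℝ) → ℝ → ℝ} (hf : EncoderPoly d n m A f)
      (hg : EncoderPoly d n' m' A' g) :
      EncoderPoly d (n + n') (m + m') (A * A') (fun r t => f r t * g r t)
  | add {n m : ℕ} {A A' : ℝ} {f g : (Y → ℝ) → ℝ → ℝ} (hf : EncoderPoly d n m A f)
      (hg : EncoderPoly d n m A' g) :
      EncoderPoly d n m (A + A') (fun r t => f r t + g r t)
  | mono {n n' m : ℕ} {A A' : ℝ} {f : (Y → ℝ) → ℝ → ℝ} (hf : EncoderPoly d n m A f)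
      (hn : n ≤ n') (hA : A ≤ A') : EncoderPoly d n' m A' f

namespace EncoderPoly

variable {X Y : Type*} [Fintype Y] {d : X → Y → ℝ} {n m : ℕ} {A : ℝ} {f : (Y → ℝ) → ℝ → ℝ}

theorem congr (hf : EncoderPoly d n m A f) {n' m' : ℕ} {A' : ℝ} (hn : n ≤ n') (hm : m = m')
    (hA : A ≤ A') : EncoderPoly d n' m' A' f :=
  hm ▸ hf.mono hn hA

theorem nonneg (hf : EncoderPoly d n m A f) : 0 ≤ A := by
  induction hf with
  | zero => exact le_rfl
  | avg => exact zero_le_one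
  | ratio => exact zero_le_one
  | smul c _ ih => exact mul_nonneg (abs_nonneg c) ih
  | mul _ _ ih ih' => exact mul_nonneg ih ih'
  | add _ _ ih ih' => exact add_nonneg ih ih'
  | mono _ _ hA ih => exact ih.trans hA

theorem sum {ι : Type*} (s : Finset ι) {a : ι → ℝ} {g : ι → (Y → ℝ) → ℝ → ℝ}
    (h : ∀ j ∈ s, EncoderPoly d n m (a j) (g j)) :
    EncoderPoly d n m (∑ j ∈ s, a j) (fun r t => ∑ j ∈ s, g j r t) := by
  classical
  induction s using Finset.induction_on with
  | empty => simpa using zero n m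
  | insert j s hj ih =>
    simp only [Finset.sum_insert hj]
    exact (h j (Finset.mem_insert_self _ _)).add
      (ih fun k hk => h k (Finset.mem_insert_of_mem hk))

/-- Averages are at most 1 for any admissible `r`, so only the `m` ratios in each monomial cost a
factor `B`. For `m = 0` the value of `B` is irrelevant. -/
theorem abs_le (hf : EncoderPoly d n m A f) {B : ℝ} {r : Y → ℝ} {t : ℝ} (h0 : ∀ y, 0 ≤ r y)
    (h1 : ∃ y, 0 < r y) (hB : ∀ x i, weightRatio d x i r t ≤ B) (hB0 : 0 ≤ B) :
    |f r t| ≤ A * B ^ m := by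
  induction hf with
  | zero => simp
  | avg x F hF => simpa using abs_encoderAvg_le d hF h0 (partitionFun_pos d h0 h1 t x)
  | ratio x i => simpa [abs_of_nonneg (weightRatio_nonneg d h0 t x i)] using hB x i
  | smul c _ ih =>
    rw [abs_mul, mul_assoc]
    exact mul_le_mul_of_nonneg_left ih (abs_nonneg c)
  | mul hf _ ih ih' =>
    rw [abs_mul, pow_add, mul_mul_mul_comm]
    exact mul_le_mul ih ih' (abs_nonneg _) (mul_nonneg hf.nonneg (pow_nonneg hB0 _))
  | add _ _ ih ih' =>
    rw [add_mul]
    exact (abs_add_le _ _).trans (add_le_add ih ih')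
  | mono _ _ hA ih => exact ih.trans (mul_le_mul_of_nonneg_right hA (pow_nonneg hB0 _))

theorem contDiffAt (hf : EncoderPoly d n m A f) {r : Y → ℝ} {t : ℝ} (h0 : ∀ y, 0 ≤ r y)
    (h1 : ∃ y, 0 < r y) : ContDiffAt ℝ ∞ (fun z : (Y → ℝ) × ℝ => f z.1 z.2) (r, t) := by
  have hZ : ∀ x, partitionFun d t r x ≠ 0 := fun x => (partitionFun_pos d h0 h1 t x).ne'
  induction hf with
  | zero => exact contDiffAt_const
  | avg x F _ =>
    exact (contDiff_partitionFun_mul d F x).contDiffAt.div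
      (contDiff_partitionFun d x).contDiffAt (hZ x)
  | ratio x i =>
    exact ContDiffAt.div (f := fun z : (Y → ℝ) × ℝ => Real.exp (-z.2 * d x i)) (by fun_prop)
      (contDiff_partitionFun d x).contDiffAt (hZ x)
  | smul c _ ih => exact contDiffAt_const.mul ih
  | mul _ _ ih ih' => exact ih.mul ih'
  | add _ _ ih ih' => exact ih.add ih'
  | mono _ _ _ ih => exact ih

/-- The Leibniz rule differentiates at most `n` factors per monomial, and each derivative is a
difference of two terms of size at most `D`. -/
theorem exists_hasDerivAt (hf : EncoderPoly d n m A f) {D : ℝ} (hD : 0 < D)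
    (hd : ∀ x y, |d x y| ≤ D) :
    ∃ g, EncoderPoly d (n + 1) m (2 * n * D * A) g ∧ ∀ r t, (∀ y, 0 ≤ r y) → (∃ y, 0 < r y) →
      HasDerivAt (f r) (g r t) t := by
  -- Averaged functions must be bounded by 1, so `d` enters as `D⁻¹ • d`, with `D` moved into the
  -- coefficient.
  have hdD : ∀ x, ∀ y, |(D⁻¹ • d x) y| ≤ 1 := fun x y => by
    rw [Pi.smul_apply, smul_eq_mul, abs_mul, abs_of_pos (inv_pos.2 hD), inv_mul_le_one₀ hD]
    exact hd x y
  have hsmul : ∀ x (F : Y → ℝ) r t, D * encoderAvg d x (D⁻¹ • F) r t = encoderAvg d x F r t := by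
    intro x F r t
    have : partitionFun d t (D⁻¹ • F * r) x = D⁻¹ * partitionFun d t (F * r) x := by
      simp only [partitionFun, Finset.mul_sum, Pi.mul_apply, Pi.smul_apply, smul_eq_mul, mul_assoc]
    rw [encoderAvg, encoderAvg, this]
    field_simp
  induction hf with
  | zero n m =>
    exact ⟨_, (zero (n + 1) m).congr le_rfl rfl (by simp), fun r t _ _ => hasDerivAt_const _ _⟩
  | avg x F hF =>
    have hdF : ∀ y, |(D⁻¹ • (d x * F)) y| ≤ 1 := fun y => by
      have := mul_le_mul (hdD x y) (hF y) (abs_nonneg _) zero_le_one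
      rwa [← abs_mul, one_mul, ← Pi.mul_apply, smul_mul_assoc] at this
    refine ⟨_, (((avg x F hF).mul (avg x _ (hdD x))).add
      (((avg x _ hdF).smul (-1)).mono one_le_two le_rfl) |>.smul D).congr le_rfl rfl ?_, ?_⟩
    · rw [abs_of_pos hD]; norm_num; linarith
    · intro r t h0 h1
      refine (hasDerivAt_encoderAvg d (partitionFun_pos d h0 h1 t x).ne' F).congr_deriv ?_
      rw [← hsmul x (d x), ← hsmul x (d x * F)]
      ring
  | ratio x i =>
    refine ⟨_, (((ratio x i).mul (avg x _ (hdD x))).smul D |>.add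
      (((ratio x i).smul (-d x i)).mono one_le_two le_rfl)).congr le_rfl rfl ?_, ?_⟩
    · rw [abs_of_pos hD, abs_neg]; have := hd x i; norm_num; linarith
    · intro r t h0 h1
      refine (hasDerivAt_weightRatio d (partitionFun_pos d h0 h1 t x).ne' i).congr_deriv ?_
      rw [← hsmul x (d x)]
      ring
  | smul c _ ih =>
    obtain ⟨g, hg, h⟩ := ih
    exact ⟨_, (hg.smul c).congr le_rfl rfl (le_of_eq (by ring)),
      fun r t h0 h1 => (h r t h0 h1).const_mul c⟩
  | mul hf hf' ih ih' =>
    obtain ⟨g, hg, h⟩ := ih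
    obtain ⟨g', hg', h'⟩ := ih'
    exact ⟨_, ((hg.mul hf').congr (by omega) rfl le_rfl |>.add
      ((hf.mul hg').congr (by omega) rfl le_rfl)).congr le_rfl rfl
        (le_of_eq (by push_cast; ring)), fun r t h0 h1 => (h r t h0 h1).mul (h' r t h0 h1)⟩
  | add _ _ ih ih' =>
    obtain ⟨g, hg, h⟩ := ih
    obtain ⟨g', hg', h'⟩ := ih'
    exact ⟨_, (hg.add hg').congr le_rfl rfl (le_of_eq (by ring)),
      fun r t h0 h1 => (h r t h0 h1).add (h' r t h0 h1)⟩
  | mono hf hn hA ih =>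
    obtain ⟨g, hg, h⟩ := ih
    have := hf.nonneg
    exact ⟨g, hg.congr (by omega) rfl (by gcongr), h⟩

/-- Same count as for β, but no `D` appears: the only new coefficients are `F i` and -1. -/
theorem exists_hasLineDerivAt [DecidableEq Y] (hf : EncoderPoly d n m A f) (i : Y) :
    ∃ g, EncoderPoly d (n + 1) (m + 1) (2 * n * A) g ∧
      ∀ r t, (∀ y, 0 ≤ r y) → (∃ y, 0 < r y) →
        HasLineDerivAt ℝ (fun r => f r t) (g r t) r (Pi.single i 1) := by
  induction hf with
  | zero n m =>
    exact ⟨_, (zero (n + 1) (m + 1)).congr le_rfl rfl (by simp),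
      fun r t _ _ => hasDerivAt_const _ _⟩
  | avg x F hF =>
    refine ⟨_, ((((ratio x i).smul (F i)).mono one_le_two le_rfl).add
      (((ratio x i).mul (avg x F hF)).smul (-1))).congr le_rfl rfl ?_, ?_⟩
    · have := hF i; norm_num; linarith
    · intro r t h0 h1
      refine (hasLineDerivAt_encoderAvg d (partitionFun_pos d h0 h1 t x).ne' F i).congr_deriv ?_
      ring
  | ratio x j =>
    refine ⟨_, (((ratio x i).mul (ratio x j)).smul (-1)).congr le_rfl rfl (by norm_num), ?_⟩
    intro r t h0 h1
    refine (hasLineDerivAt_weightRatio d (partitionFun_pos d h0 h1 t x).ne' j i).congr_deriv ?_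
    ring
  | smul c _ ih =>
    obtain ⟨g, hg, h⟩ := ih
    exact ⟨_, (hg.smul c).congr le_rfl rfl (le_of_eq (by ring)),
      fun r t h0 h1 => HasDerivAt.const_mul c (h r t h0 h1)⟩
  | mul hf hf' ih ih' =>
    obtain ⟨g, hg, h⟩ := ih
    obtain ⟨g', hg', h'⟩ := ih'
    refine ⟨_, ((hg.mul hf').congr (by omega) (by omega) le_rfl |>.add
      ((hf.mul hg').congr (by omega) rfl le_rfl)).congr le_rfl rfl
        (le_of_eq (by push_cast; ring)), fun r t h0 h1 => ?_⟩
    refine (HasDerivAt.mul (h r t h0 h1) (h' r t h0 h1)).congr_deriv ?_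
    simp only [zero_smul, add_zero]
  | add _ _ ih ih' =>
    obtain ⟨g, hg, h⟩ := ih
    obtain ⟨g', hg', h'⟩ := ih'
    exact ⟨_, (hg.add hg').congr le_rfl rfl (le_of_eq (by ring)),
      fun r t h0 h1 => HasDerivAt.add (h r t h0 h1) (h' r t h0 h1)⟩
  | mono hf hn hA ih =>
    obtain ⟨g, hg, h⟩ := ih
    have := hf.nonneg
    exact ⟨g, hg.congr (by omega) rfl (by gcongr), h⟩

end EncoderPoly

/-! ### Derivatives of the operator -/

section Operator

variable {X Y : Type*} [Fintype X] [Fintype Y]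

theorem encoderPoly_blahutArimoto {p : X → ℝ} (hp : p ∈ stdSimplex ℝ X) (d : X → Y → ℝ) (y : Y) :
    EncoderPoly d 1 0 1 (fun r t => blahutArimoto p d t r y) := by
  classical
  have h : ∀ x ∈ (Finset.univ : Finset X), EncoderPoly d 1 0 (|p x| * 1)
      (fun r t => p x * encoderAvg d x (Pi.single y 1) r t) := fun x _ =>
    (EncoderPoly.avg x _ fun z => by
      rcases eq_or_ne z y with rfl | hz
      · simp
      · simp [Pi.single_eq_of_ne hz]).smul (p x)
  have hs := EncoderPoly.sum _ h
  simp only [mul_one, abs_of_nonneg (hp.1 _), hp.2, ← encoder_eq_encoderAvg] at hs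
  exact hs

/-- The constant is the product of 2kD over k = 1, …, b. Allowing unnormalized `r` leaves room to
differentiate in `r` afterwards. -/
theorem exists_iteratedDeriv_rdOperator {p : X → ℝ} (hp : p ∈ stdSimplex ℝ X) {d : X → Y → ℝ}
    {D : ℝ} (hD : 0 < D) (hd : ∀ x y, |d x y| ≤ D) (b : ℕ) (y : Y) :
    ∃ g, EncoderPoly d (b + 1) 0 (2 ^ b * b.factorial * D ^ b) g ∧
      ∀ r, (∀ y, 0 ≤ r y) → (∃ y, 0 < r y) →
        iteratedDeriv b (fun t => rdOperator p d t r y) =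
          fun t => (if b = 0 then 1 else 0) * r y - g r t := by
  induction b with
  | zero =>
    refine ⟨_, (encoderPoly_blahutArimoto hp d y).congr le_rfl rfl (by simp), fun r _ _ => ?_⟩
    ext t
    simp [rdOperator]
  | succ b ih =>
    obtain ⟨g, hg, h⟩ := ih
    obtain ⟨g', hg', h'⟩ := hg.exists_hasDerivAt hD hd
    refine ⟨g', hg'.congr le_rfl rfl (le_of_eq ?_), fun r h0 h1 => ?_⟩
    · rw [Nat.factorial_succ]
      push_cast
      ring
    · rw [iteratedDeriv_succ, h r h0 h1]
      ext t
      simpa using ((h' r t h0 h1).const_sub ((if b = 0 then 1 else 0) * r y)).deriv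

/-- The term `c * r y + a` is what remains of the identity: a coordinate, then a constant, then 0.
Strict positivity of `r` is an open condition, so the formula can be differentiated again. -/
theorem exists_derivTensorEntry [DecidableEq Y] {p : X → ℝ} (hp : p ∈ stdSimplex ℝ X)
    {d : X → Y → ℝ} {D : ℝ} (hD : 0 < D) (hd : ∀ x y, |d x y| ≤ D) (b m : ℕ) (β : ℝ) (y : Y)
    (i : Fin m → Y) :
    ∃ g, EncoderPoly d (b + m + 1) m (2 ^ (b + m) * (b + m).factorial * D ^ b) g ∧
      ∃ c a : ℝ, |c| + |a| ≤ 1 ∧ (b ≠ 0 ∨ m ≠ 0 → c = 0) ∧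
        ∀ r, (∀ y, 0 < r y) → derivTensorEntry p d b m β r y i = c * r y + a - g r β := by
  obtain ⟨g₀, hg₀, h₀⟩ := exists_iteratedDeriv_rdOperator hp hD hd b y
  induction m with
  | zero =>
    refine ⟨g₀, hg₀, if b = 0 then 1 else 0, 0, ?_, ?_, fun r hr => ?_⟩
    · split_ifs <;> simp
    · rintro (h | h)
      · simp [h]
      · exact absurd rfl h
    · simp only [derivTensorEntry, derivTensor, iteratedFDeriv_zero_apply, add_zero]
      rw [h₀ r (fun z => (hr z).le) ⟨y, hr y⟩]
  | succ m ih =>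
    obtain ⟨g, hg, c, a, hca, -, h⟩ := ih (Fin.tail i)
    obtain ⟨g', hg', h'⟩ := hg.exists_hasLineDerivAt (i 0)
    refine ⟨g', hg'.congr le_rfl rfl (le_of_eq ?_), 0,
      c * (Pi.single (i 0) 1 : Y → ℝ) y, ?_, fun _ => rfl, fun r hr => ?_⟩
    · rw [← add_assoc, Nat.factorial_succ]
      push_cast
      ring
    · have : |(Pi.single (i 0) 1 : Y → ℝ) y| ≤ 1 := by
        rcases eq_or_ne y (i 0) with hy | hy
        · simp [hy]
        · simp [Pi.single_eq_of_ne hy]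
      rw [abs_zero, zero_add, abs_mul]
      exact (mul_le_of_le_one_right (abs_nonneg c) this).trans (by linarith [abs_nonneg a])
    · have h0 : ∀ z, 0 ≤ r z := fun z => (hr z).le
      have hopen : ∀ᶠ s in nhds r, ∀ z, 0 < s z := by
        refine (Filter.eventually_all).2 fun z => ?_
        exact (continuous_apply z).continuousAt.eventually (lt_mem_nhds (hr z))
      have hsmooth : ContDiffAt ℝ ∞
          (fun s : Y → ℝ => iteratedDeriv b (fun t => rdOperator p d t s y) β) r := by
        have hc : ContDiffAt ℝ ∞ (fun s : Y → ℝ => (if b = 0 then 1 else 0) * s y - g₀ s β) r := by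
          have := (hg₀.contDiffAt h0 ⟨y, hr y⟩ (t := β)).comp (f := fun s : Y → ℝ => (s, β)) r
            (by fun_prop)
          exact ContDiffAt.sub (by fun_prop) this
        refine hc.congr_of_eventuallyEq (hopen.mono fun s hs => ?_)
        exact congrFun (h₀ s (fun z => (hs z).le) ⟨y, hs y⟩) β
      have hdiff : DifferentiableAt ℝ (iteratedFDeriv ℝ m
          (fun s : Y → ℝ => iteratedDeriv b (fun t => rdOperator p d t s y) β)) r :=
        hsmooth.differentiableAt_iteratedFDeriv (by exact_mod_cast WithTop.coe_lt_top _)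
      have hentry : HasFDerivAt (fun s => derivTensorEntry p d b m β s y (Fin.tail i)) _ r :=
        ((ContinuousMultilinearMap.apply ℝ (fun _ : Fin m => Y → ℝ) ℝ
          (fun j => Pi.single (Fin.tail i j) (1 : ℝ))).hasFDerivAt).comp r hdiff.hasFDerivAt
      have hline := hentry.hasLineDerivAt (Pi.single (i 0) 1)
      have hformula : HasLineDerivAt ℝ (fun s => derivTensorEntry p d b m β s y (Fin.tail i))
          (c * (Pi.single (i 0) 1 : Y → ℝ) y - g' r β) r (Pi.single (i 0) 1) := by
        refine HasLineDerivAt.congr_of_eventuallyEq (f := fun s => c * s y + a - g s β) ?_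
          (hopen.mono fun s hs => h s hs)
        have hcoord : HasDerivAt (fun s : ℝ => c * (r + s • (Pi.single (i 0) 1 : Y → ℝ)) y + a)
            (c * (Pi.single (i 0) 1 : Y → ℝ) y) 0 := by
          simpa using ((((hasDerivAt_id (0 : ℝ)).mul_const
            ((Pi.single (i 0) 1 : Y → ℝ) y)).const_add (r y)).const_mul c).add_const a
        exact hcoord.sub (h' r β h0 ⟨y, hr y⟩)
      rw [zero_mul, zero_add]
      -- By definition of `iteratedFDeriv`, the entry of order m + 1 at `i` is the derivative along
      -- the basis vector of `i 0` of the entry at `Fin.tail i`.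
      exact hline.unique hformula

theorem abs_le_distortionMax {d : X → Y → ℝ} (hd : ∀ x y, 0 ≤ d x y) (x : X) (y : Y) :
    |d x y| ≤ distortionMax d := by
  rw [abs_of_nonneg (hd x y)]
  exact le_max_of_le_right
    (le_ciSup (f := fun z : X × Y => d z.1 z.2) (Set.finite_range _).bddAbove (x, y))

end Operator

/-! ### Comparison of constants -/

section Bounds

theorem two_pow_le_factorial_succ (m : ℕ) : 2 ^ m ≤ (m + 1).factorial := by
  induction m with
  | zero => simp
  | succ m ih =>
    rw [Nat.factorial_succ, pow_succ, mul_comm]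
    exact Nat.mul_le_mul (by omega) ih

theorem two_pow_mul_factorial_add_le (b m : ℕ) :
    2 ^ (b + m) * (b + m).factorial ≤
      2 * (m + 1).factorial * (m.factorial * (2 ^ b * b.factorial) ^ (1 + m)) := by
  have h2 := two_pow_le_factorial_succ m
  have hb := Nat.factorial_pos b
  have hm := Nat.factorial_pos m
  rcases Nat.eq_zero_or_pos b with rfl | hb1
  · simp only [zero_add, pow_zero, Nat.factorial_zero, one_pow, mul_one]
    gcongr
    omega
  rcases Nat.eq_zero_or_pos m with rfl | hm1
  · simp
    omega
  have hfac : (b + m).factorial ≤ 2 ^ (b + m) * (b.factorial * m.factorial) := by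
    rw [← Nat.add_choose_mul_factorial_mul_factorial b m, mul_assoc]
    exact Nat.mul_le_mul_right _ (Nat.choose_le_two_pow _ _)
  -- In exponents this is b + m ≤ 1 + bm, that is (b - 1)(m - 1) ≥ 0; hence the separate cases b = 0
  -- and m = 0.
  have hexp : 2 ^ (b + m) * 2 ^ (b + m) ≤ 2 * 2 ^ m * (2 ^ b) ^ (1 + m) := by
    rw [← pow_add, ← pow_succ', ← pow_mul, ← pow_add]
    refine Nat.pow_le_pow_right two_pos ?_
    obtain ⟨k, rfl⟩ := Nat.exists_eq_add_of_le hb1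
    obtain ⟨l, rfl⟩ := Nat.exists_eq_add_of_le hm1
    nlinarith [Nat.zero_le (k * l)]
  calc 2 ^ (b + m) * (b + m).factorial
      ≤ 2 ^ (b + m) * (2 ^ (b + m) * (b.factorial * m.factorial)) := by gcongr
    _ = (2 ^ (b + m) * 2 ^ (b + m)) * (m.factorial * b.factorial ^ 1) := by ring
    _ ≤ (2 * (m + 1).factorial * (2 ^ b) ^ (1 + m)) *
        (m.factorial * b.factorial ^ (1 + m)) := by
      refine Nat.mul_le_mul (hexp.trans (by gcongr)) ?_
      exact Nat.mul_le_mul_left _ (Nat.pow_le_pow_right hb (by omega))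
    _ = _ := by ring

/-- All remaining factors of the constant are at least 1, and so is the bracket `K`; as `Y` is
nonempty, `K` is at most its power. -/
theorem two_pow_mul_factorial_mul_le_tensorConst {X Y : Type*} [Fintype Y] [Nonempty Y]
    (d : X → Y → ℝ) (b m : ℕ) :
    2 ^ (b + m) * (b + m).factorial * distortionMax d ^ b ≤ tensorConst d b m := by
  have hD : 1 ≤ distortionMax d := le_max_left _ _
  have hp : (1 : ℝ) ≤ Fintype.card (Nat.Partition b) := by exact_mod_cast Fintype.card_pos
  have hb : (1 : ℝ) ≤ (max 1 b : ℕ) := by exact_mod_cast le_max_left _ _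
  have hM : 0 < Fintype.card Y := Fintype.card_pos
  have hch : (1 : ℝ) ≤ Nat.choose (b + Fintype.card Y - 1) b := by
    exact_mod_cast Nat.choose_pos (by omega)
  have hf : (1 : ℝ) ≤ m.factorial := by exact_mod_cast m.factorial_pos
  have hfb : (1 : ℝ) ≤ b.factorial := by exact_mod_cast b.factorial_pos
  have h2 : (1 : ℝ) ≤ 2 ^ b := one_le_pow₀ one_le_two
  have hDb : distortionMax d ^ b ≤ (distortionMax d ^ b ^ 2) ^ (1 + m) := by
    rw [← pow_mul]
    refine pow_le_pow_right₀ hD ?_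
    nlinarith [Nat.le_self_pow two_ne_zero b, Nat.zero_le (b ^ 2 * m)]
  have hmain : (2 : ℝ) ^ (b + m) * (b + m).factorial ≤
      2 * (m + 1).factorial * (m.factorial * (2 ^ b * b.factorial) ^ (1 + m)) := by
    exact_mod_cast two_pow_mul_factorial_add_le b m
  set K : ℝ := (m.factorial : ℝ) * (Fintype.card (Nat.Partition b) : ℝ) *
    ((2 : ℝ) ^ b * (b.factorial : ℝ) * distortionMax d ^ (b ^ 2)) ^ (1 + m) with hK
  have hK1 : 1 ≤ K := by
    have : (1 : ℝ) ≤ 2 ^ b * b.factorial * distortionMax d ^ b ^ 2 :=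
      one_le_mul_of_one_le_of_one_le (one_le_mul_of_one_le_of_one_le h2 hfb) (one_le_pow₀ hD)
    exact one_le_mul_of_one_le_of_one_le (one_le_mul_of_one_le_of_one_le hf hp)
      (one_le_pow₀ this)
  have hinner : (m.factorial : ℝ) * (2 ^ b * b.factorial) ^ (1 + m) * distortionMax d ^ b ≤ K := by
    rw [hK, mul_pow _ (distortionMax d ^ b ^ 2), ← mul_assoc]
    gcongr
    exact le_mul_of_one_le_right (by positivity) hp
  calc 2 ^ (b + m) * (b + m).factorial * distortionMax d ^ b
      ≤ 2 * (m + 1).factorial * (m.factorial * (2 ^ b * b.factorial) ^ (1 + m)) *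
        distortionMax d ^ b := by gcongr
    _ = 2 * 1 * (m + 1).factorial * 1 *
        (m.factorial * (2 ^ b * b.factorial) ^ (1 + m) * distortionMax d ^ b) := by ring
    _ ≤ 2 * (max 1 b : ℕ) * (m + 1).factorial * Nat.choose (b + Fintype.card Y - 1) b *
        K ^ Fintype.card Y := by
      gcongr
      exact hinner.trans (le_self_pow₀ hK1 hM.ne')
    _ = tensorConst d b m := rfl

theorem exists_pos_of_mem_stdSimplex {Y : Type*} [Fintype Y] {r : Y → ℝ}
    (hr : r ∈ stdSimplex ℝ Y) : ∃ y, 0 < r y := by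
  by_contra! h
  have := hr.2 ▸ Finset.sum_nonpos fun y (_ : y ∈ Finset.univ) => h y
  linarith

end Bounds

end RateDistortion

open RateDistortion in
theorem mainTheorem10 {X Y : Type*} [Fintype X] [Fintype Y] [DecidableEq Y]
    (p : X → ℝ) (hp : p ∈ stdSimplex ℝ X)
    (d : X → Y → ℝ) (hd : ∀ x y, 0 ≤ d x y) :
    -- near the simplex all the partial derivatives exist
    (∀ (β : ℝ), ∀ r ∈ stdSimplex ℝ Y, ∀ y : Y,
      ContDiffAt ℝ ∞ (fun z : (Y → ℝ) × ℝ => RateDistortion.rdOperator p d z.2 z.1 y) (r, β)) ∧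
    -- the bound on the closed interior
    (∀ δ : ℝ, 0 < δ → ∀ b m : ℕ, ¬ (b = 0 ∧ m = 0) →
      ∀ (β : ℝ), ∀ r ∈ RateDistortion.closedInterior Y δ, ∀ (y : Y) (i : Fin m → Y),
        |RateDistortion.derivTensorEntry p d b m β r y i| ≤
          1 + 1 / δ ^ m * RateDistortion.tensorConst d b m) ∧
    -- derivatives with respect to `β` alone, on the whole simplex
    (∀ b : ℕ, 0 < b → ∀ (β : ℝ), ∀ r ∈ stdSimplex ℝ Y, ∀ y : Y,
      |iteratedDeriv b (fun t : ℝ => RateDistortion.rdOperator p d t r y) β| ≤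
        1 + RateDistortion.tensorConst d b 0) := by
  have hD : 0 < distortionMax d := zero_lt_one.trans_le (le_max_left _ _)
  have hdD := abs_le_distortionMax hd
  refine ⟨fun β r hr y => ?_, fun δ hδ b m hbm β r hr y i => ?_, fun b hb β r hr y => ?_⟩
  · have h := (encoderPoly_blahutArimoto hp d y).contDiffAt (t := β) hr.1
      (exists_pos_of_mem_stdSimplex hr)
    exact ContDiffAt.sub (f := fun z : (Y → ℝ) × ℝ => z.1 y) (by fun_prop) h
  · have : Nonempty Y := ⟨y⟩
    obtain ⟨g, hg, c, a, hca, hc, h⟩ := exists_derivTensorEntry hp hD hdD b m β y i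
    have hc0 : c = 0 := hc (by tauto)
    have hr0 : ∀ z, 0 < r z := fun z => hδ.trans_le (hr.2 z)
    rw [h r hr0, hc0, zero_mul, zero_add]
    have hbound := hg.abs_le (t := β) hr.1.1 ⟨y, hr0 y⟩
      (fun x z => weightRatio_le d hδ hr.2 β x z) (one_div_nonneg.2 hδ.le)
    have hC := mul_le_mul_of_nonneg_right (two_pow_mul_factorial_mul_le_tensorConst d b m)
      (pow_nonneg (one_div_nonneg.2 hδ.le) m)
    rw [one_div_pow, mul_comm (tensorConst d b m)] at hC
    rw [one_div_pow] at hbound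
    refine (abs_sub _ _).trans (add_le_add ?_ (hbound.trans hC))
    linarith [abs_nonneg c]
  · have : Nonempty Y := ⟨y⟩
    have h1 := exists_pos_of_mem_stdSimplex hr
    obtain ⟨g, hg, h⟩ := exists_iteratedDeriv_rdOperator hp hD hdD b y
    -- No uniform bound on the ratios exists here, but the polynomial has none (`m = 0`), so any
    -- finite `B` serves; the sum of all ratios is one.
    have hbound := hg.abs_le (B := ∑ x, ∑ z, weightRatio d x z r β) (t := β) hr.1 h1
      (fun x z => (Finset.single_le_sum (f := fun z => weightRatio d x z r β)
        (fun z _ => weightRatio_nonneg d hr.1 β x z) (Finset.mem_univ z)).trans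
        (Finset.single_le_sum (f := fun x => ∑ z, weightRatio d x z r β)
        (fun x _ => Finset.sum_nonneg fun z _ => weightRatio_nonneg d hr.1 β x z)
        (Finset.mem_univ x)))
      (Finset.sum_nonneg fun x _ => Finset.sum_nonneg fun z _ => weightRatio_nonneg d hr.1 β x z)
    simp only [h r hr.1 h1, if_neg hb.ne', zero_mul, zero_sub, abs_neg]
    have hC := two_pow_mul_factorial_mul_le_tensorConst d b 0
    rw [add_zero] at hC
    rw [pow_zero, mul_one] at hbound
    linarith
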